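/- Let $n\ge 1$ and let $K$ be an ordered field (for instance $K=\mathbb{Q}$ or $K=\mathbb{R}$). Let $W=S_{n+1}$, the Weyl group of type $A_n$, with simple reflections $S=\{s_1,\dots,s_n\}$, $s_i=(i,\,i+1)$, act by permutation of coordinates on the span $V=\{x\in K^{n+1} : \sum_k x_k=0\}$ of the simple roots $e_i-e_{i+1}$. For a dominant weight $\lambda\in V$ (that is, $\lambda_1\ge\lambda_2\ge\dots\ge\lambda_{n+1}$) let $P_\lambda=\mathrm{Conv}(W\lambda)$, and say that $\lambda$ is of type $J=\{s\in S : s\lambda=\lambda\}$. A subset $J\subseteq S$ is called combinatorially smooth if weights of type $J$ exist and $P_\lambda$ is a simple polytope (each vertex lies on exactly $\dim P_\lambda$ edges) for all of them. The $h$-polynomial of the projective toric variety $X(J)$ associated with the normal fan of $P_\lambda$, for $\lambda$ of type $J$, is $h(t)=\sum_{i=0}^{d} f_i\,(t-1)^i$, where $d=\dim P_\lambda$ and $f_i$ is the number of $i$-dimensional faces of $P_\lambda$. Let $E_m(t)=\sum_i E(m,i)\,t^i$ be the $m$-th Eulerian polynomial, where $E(m,i)$ is the number of permutations in $S_m$ with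 exactly $i$ ascents ($E_0=1$). Let $J=\{s_n\}$. Then $J$ is combinatorially smooth, and for every dominant weight $\lambda$ of type $J$ the $h$-polynomial of $X(J)$ is $$h(t)=E_{n+1}(t)-\binom{n+1}{2}\,t\,E_{n-1}(t).$$ -/

import Mathlib

open Polynomial

/-! ### Faces, simple polytopes and `h`-polynomials over an ordered field -/

section Polytopes

variable (K : Type*) {V : Type*} [Field K] [LinearOrder K] [AddCommGroup V] [Module K V]

/-- `F` is a nonempty face of `P`: the set of all points of `P` at which some linear functional
attains its maximum over `P`. The zero functional gives `P` itself. -/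
def IsFace (P F : Set V) : Prop :=
  F.Nonempty ∧ ∃ l : Module.Dual K V, F = {x | x ∈ P ∧ ∀ y ∈ P, l y ≤ l x}

/-- The dimension of (the affine span of) a set. -/
noncomputable def affDim (F : Set V) : ℕ :=
  Module.finrank K (vectorSpan K F)

/-- `P` is a simple polytope: it is the convex hull of a finite set, and each of its vertices lies
on exactly `dim P` edges. -/
def IsSimplePolytope (P : Set V) : Prop :=
  (∃ s : Set V, s.Finite ∧ P = convexHull K s) ∧
    ∀ v : V, IsFace K P {v} →
      {F : Set V | IsFace K P F ∧ affDim K F = 1 ∧ v ∈ F}.encard = (affDim K P : ℕ∞)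

/-- The number `f_i` of `i`-dimensional faces of `P`. -/
noncomputable def faceNumber (P : Set V) (i : ℕ) : ℕ :=
  {F : Set V | IsFace K P F ∧ affDim K F = i}.ncard

/-- The `h`-polynomial `h(t) = ∑ f_i (t - 1)^i`, where `i` runs from `0` to `dim P`. -/
noncomputable def hPolynomial (P : Set V) : ℤ[X] :=
  ∑ i ∈ Finset.range (affDim K P + 1), (faceNumber K P i : ℤ[X]) * (X - 1) ^ i

end Polytopes

/-! ### Weights and weight polytopes in type `A_n`

The Weyl group of type `A_n` is the symmetric group of `{0, …, n}`, acting by permutation of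
coordinates on the space of vectors of coordinate sum zero, the span of the simple roots
`e_i - e_{i+1}`. -/

section TypeA

/-- The simple reflections: `simpleReflection n i` exchanges `i` and `i + 1` in `{0, …, n}`. In the
usual numbering, which starts from one, it is `s_{i+1} = (i+1, i+2)`. -/
def simpleReflection (n : ℕ) (i : Fin n) : Equiv.Perm (Fin (n + 1)) :=
  Equiv.swap i.castSucc i.succ

variable {K : Type*} [Field K] [LinearOrder K] {n : ℕ}

/-- The action of the Weyl group: `(σ w)_{σ(k)} = w_k`. -/
def weylAct (σ : Equiv.Perm (Fin (n + 1))) (w : Fin (n + 1) → K) : Fin (n + 1) → K :=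
  fun k => w (σ.symm k)

/-- The weight polytope `P_w = Conv(W · w)`. -/
def weightPolytope (w : Fin (n + 1) → K) : Set (Fin (n + 1) → K) :=
  convexHull K (Set.range fun σ : Equiv.Perm (Fin (n + 1)) => weylAct σ w)

/-- `w` is a dominant weight (it lies in the span of the simple roots and pairs non-negatively with
each simple coroot) and `J` is the set of simple reflections that fix `w`. -/
def IsDominantOfType (J : Set (Equiv.Perm (Fin (n + 1)))) (w : Fin (n + 1) → K) : Prop :=
  ∑ k, w k = 0 ∧ (∀ i : Fin n, w i.succ ≤ w i.castSucc) ∧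
    J = {s | s ∈ Set.range (simpleReflection n) ∧ weylAct s w = w}

variable (K) in
/-- `J` is combinatorially smooth: the weight polytope of a dominant weight of type `J` is a simple
polytope. There is such a weight, and the property is required of all of them. -/
def CombinatoriallySmooth (J : Set (Equiv.Perm (Fin (n + 1)))) : Prop :=
  (∃ w : Fin (n + 1) → K, IsDominantOfType J w) ∧
    ∀ w : Fin (n + 1) → K, IsDominantOfType J w → IsSimplePolytope K (weightPolytope w)

end TypeA

/-! ### Eulerian polynomials -/

/-- The number of ascents of a permutation `σ(0) σ(1) … σ(n-1)`. -/
def ascentCount {n : ℕ} (σ : Equiv.Perm (Fin n)) : ℕ :=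
  (Finset.univ.filter fun i : Fin n => ∃ h : i.val + 1 < n, σ i < σ ⟨i.val + 1, h⟩).card

/-- The Eulerian number `E(n, i)`: the number of permutations of `n` letters with `i` ascents. -/
def eulerianNumber (n i : ℕ) : ℕ :=
  (Finset.univ.filter fun σ : Equiv.Perm (Fin n) => ascentCount σ = i).card

/-- The Eulerian polynomial `E_n(t) = ∑ E(n, i) t^i`. The sum is over `i ≤ n`; for `n ≥ 1` the term
`i = n` is zero, and `E_0 = 1`. -/
noncomputable def eulerianPolynomial (n : ℕ) : ℤ[X] :=
  ∑ i ∈ Finset.range (n + 1), (eulerianNumber n i : ℤ[X]) * X ^ i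

/-!
For `v` in the orbit of `u`, the functionals that attain their maximum over the orbit at `v` form
the cone of all `c` with `c x ≤ c y` for every pair `(x, y)` at which `v` takes consecutive values.
When the roots `e_y - e_x` of these pairs are linearly independent the cone is simplicial: the faces
of the orbit polytope through `v` correspond to the sets of pairs, and the polytope is simple.

Breaking ties in `c` by the order of the coordinates assigns to every face one of its vertices `v`,
and the faces assigned to `v` correspond to the sets of ascending pairs `x < y`. By the binomial
theorem `h(t) = ∑ t ^ a(v)`, where `v` runs over the orbit and `a(v)` is the number of ascending
pairs of `v`.

A weight of type `{s_n}` takes its smallest value twice and every other value once. Then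
`2 h(t) = ∑ t ^ d(σ)`, where `σ` runs over the permutations of `n + 1` letters and `d(σ)` counts the
ascents of the word `σ` with its first two letters `a`, `b` placed in the same position. Comparing
the next letter with `a` and `b` gives
`t ^ d(abρ) + t * t ^ asc(ρ) = t ^ asc(abρ) + t ^ asc(baρ)`, and summing over all permutations
yields the formula.
-/

section Faces

variable {K V : Type*} [Field K] [LinearOrder K] [AddCommGroup V] [Module K V]

theorem affDim_convexHull (s : Set V) : affDim K (convexHull K s) = affDim K s := by
  rw [affDim, affDim, ← direction_affineSpan, affineSpan_convexHull, direction_affineSpan]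

theorem hPolynomial_eq_sum [FiniteDimensional K V] {α : Type*} {P : Set V} {T : Finset α}
    {φ : α → Set V} (hφ : Set.BijOn φ T {F | IsFace K P F}) :
    hPolynomial K P = ∑ t ∈ T, (X - 1 : ℤ[X]) ^ affDim K (φ t) := by
  have hdim : ∀ t ∈ T, affDim K (φ t) ∈ Finset.range (affDim K P + 1) := by
    intro t ht
    obtain ⟨-, l, hl⟩ := hφ.mapsTo ht
    rw [Finset.mem_range, Nat.lt_succ_iff, affDim, affDim]
    exact Submodule.finrank_mono (vectorSpan_mono K (hl ▸ fun x hx => hx.1))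
  rw [hPolynomial, ← Finset.sum_fiberwise_of_maps_to hdim]
  refine Finset.sum_congr rfl fun i _ => ?_
  have hfiber : {F | IsFace K P F ∧ affDim K F = i} = φ '' {t ∈ T | affDim K (φ t) = i} := by
    ext F
    constructor
    · rintro ⟨hF, rfl⟩
      obtain ⟨t, ht, rfl⟩ := hφ.surjOn hF
      exact ⟨t, ⟨ht, rfl⟩, rfl⟩
    · rintro ⟨t, ⟨ht, rfl⟩, rfl⟩
      exact ⟨hφ.mapsTo ht, rfl⟩
  rw [faceNumber, hfiber, (hφ.injOn.mono fun t ht => ht.1).ncard_image, ← Finset.coe_filter,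
    Set.ncard_coe_finset, ← nsmul_eq_mul, ← Finset.sum_const]
  exact Finset.sum_congr rfl fun t ht => by rw [(Finset.mem_filter.1 ht).2]

variable [IsStrictOrderedRing K]

theorem le_of_mem_convexHull {s : Set V} {l : Module.Dual K V} {M : K} (hM : ∀ y ∈ s, l y ≤ M)
    {x : V} (hx : x ∈ convexHull K s) : l x ≤ M :=
  convexHull_min (t := {y | l y ≤ M}) hM (convex_halfSpace_le l.isLinear M) hx

theorem convex_lt_union {B : Set V} (hB : Convex K B) {l : Module.Dual K V} {M : K}
    (hM : ∀ y ∈ B, l y ≤ M) : Convex K ({y | l y < M} ∪ B) := by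
  rw [convex_iff_forall_pos]
  have hmix {a b r s : K} (ha : 0 < a) (hb : 0 < b) (hab : a + b = 1) (hr : r < M) (hs : s ≤ M) :
      a * r + b * s < M :=
    calc a * r + b * s < a * M + b * M :=
        add_lt_add_of_lt_of_le (mul_lt_mul_of_pos_left hr ha) (mul_le_mul_of_nonneg_left hs hb.le)
      _ = M := by rw [← add_mul, hab, one_mul]
  rintro y (hy | hy) z (hz | hz) a b ha hb hab
  · exact Or.inl (by simpa using hmix ha hb hab hy hz.le)
  · exact Or.inl (by simpa using hmix ha hb hab hy (hM z hz))
  · exact Or.inl (by simpa [add_comm] using hmix hb ha (by rwa [add_comm]) hz (hM y hy))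
  · exact Or.inr (hB hy hz ha.le hb.le hab)

theorem maximizers_convexHull (s : Set V) (l : Module.Dual K V) :
    {x | x ∈ convexHull K s ∧ ∀ y ∈ convexHull K s, l y ≤ l x} =
      convexHull K {x | x ∈ s ∧ ∀ y ∈ s, l y ≤ l x} := by
  have hsub : convexHull K {x | x ∈ s ∧ ∀ y ∈ s, l y ≤ l x} ⊆ convexHull K s :=
    convexHull_mono fun x hx => hx.1
  refine Set.Subset.antisymm ?_ fun x hx => ⟨hsub hx, fun y hy => ?_⟩
  · rintro x ⟨hx, hmax⟩
    have hle : ∀ y ∈ s, l y ≤ l x := fun y hy => hmax y (subset_convexHull K s hy)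
    have hcover : s ⊆ {y | l y < l x} ∪ convexHull K {x | x ∈ s ∧ ∀ y ∈ s, l y ≤ l x} :=
      fun y hy => (hle y hy).lt_or_eq.imp id fun h =>
        subset_convexHull K _ ⟨hy, fun z hz => (hle z hz).trans h.ge⟩
    exact (convexHull_min hcover (convex_lt_union (convex_convexHull K _)
      fun y hy => hmax y (hsub hy)) hx).resolve_left (lt_irrefl _)
  · refine le_of_mem_convexHull (fun z hz => ?_) hy
    have := le_of_mem_convexHull (l := -l) (M := -l z) (fun w hw => neg_le_neg (hw.2 z hz)) hx
    exact neg_le_neg_iff.1 this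

theorem isFace_convexHull_iff {s F : Set V} :
    IsFace K (convexHull K s) F ↔
      F.Nonempty ∧ ∃ l : Module.Dual K V, F = convexHull K {x | x ∈ s ∧ ∀ y ∈ s, l y ≤ l x} := by
  simp only [IsFace, maximizers_convexHull]

theorem inter_convexHull_maximizers (s : Set V) (l : Module.Dual K V) :
    s ∩ convexHull K {x | x ∈ s ∧ ∀ y ∈ s, l y ≤ l x} = {x | x ∈ s ∧ ∀ y ∈ s, l y ≤ l x} := by
  refine Set.Subset.antisymm ?_ fun x hx => ⟨hx.1, subset_convexHull K _ hx⟩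
  rintro x ⟨hxs, hx⟩
  rw [← maximizers_convexHull] at hx
  exact ⟨hxs, fun y hy => hx.2 y (subset_convexHull K s hy)⟩

end Faces

section PermOrbit

open Equiv Matrix

theorem exists_equiv_fin_monotone {ι β : Type*} [Fintype ι] [LinearOrder β] (g : ι → β) :
    ∃ e : Fin (Fintype.card ι) ≃ ι, Monotone (g ∘ e) := by
  let e := (Fintype.equivFin ι).symm
  exact ⟨(Tuple.sort (g ∘ e)).trans e, Tuple.monotone_sort (g ∘ e)⟩

variable {ι K : Type*} [Fintype ι] [DecidableEq ι]

/-- The orbit of `u` under permutation of coordinates. -/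
def permOrbit [DecidableEq K] (u : ι → K) : Finset (ι → K) :=
  Finset.univ.image fun σ : Perm ι => u ∘ σ

theorem mem_permOrbit [DecidableEq K] {u v : ι → K} :
    v ∈ permOrbit u ↔ ∃ σ : Perm ι, u ∘ σ = v := by
  simp [permOrbit]

theorem self_mem_permOrbit [DecidableEq K] (u : ι → K) : u ∈ permOrbit u :=
  mem_permOrbit.2 ⟨1, rfl⟩

theorem comp_mem_permOrbit [DecidableEq K] {u v : ι → K} (hv : v ∈ permOrbit u) (σ : Perm ι) :
    v ∘ σ ∈ permOrbit u := by
  obtain ⟨τ, rfl⟩ := mem_permOrbit.1 hv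
  exact mem_permOrbit.2 ⟨τ * σ, rfl⟩

theorem permOrbit_eq_of_mem [DecidableEq K] {u v : ι → K} (hv : v ∈ permOrbit u) :
    permOrbit v = permOrbit u := by
  obtain ⟨τ, rfl⟩ := mem_permOrbit.1 hv
  refine Finset.Subset.antisymm (fun w hw => ?_) fun w hw => ?_
  · obtain ⟨σ, rfl⟩ := mem_permOrbit.1 hw
    exact comp_mem_permOrbit hv σ
  · obtain ⟨σ, rfl⟩ := mem_permOrbit.1 hw
    exact mem_permOrbit.2 ⟨τ⁻¹ * σ, by ext i; simp⟩

theorem sum_comp_perm_eq_card_smul_sum_permOrbit [DecidableEq K] {M : Type*} [AddCommMonoid M]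
    (u : ι → K) (f : (ι → K) → M) :
    ∑ σ : Perm ι, f (u ∘ σ) =
      (Finset.univ.filter fun σ : Perm ι => u ∘ σ = u).card • ∑ v ∈ permOrbit u, f v := by
  rw [permOrbit, ← Finset.sum_fiberwise_of_maps_to
    (fun σ hσ => Finset.mem_image_of_mem (fun σ : Perm ι => u ∘ σ) hσ), Finset.smul_sum]
  refine Finset.sum_congr rfl fun v hv => ?_
  obtain ⟨τ, -, rfl⟩ := Finset.mem_image.1 hv
  rw [Finset.sum_congr rfl fun σ hσ => congrArg f (Finset.mem_filter.1 hσ).2, Finset.sum_const]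
  congr 1
  refine Finset.card_equiv (Equiv.mulRight τ⁻¹) fun σ => ?_
  simp only [Finset.mem_filter, Finset.mem_univ, true_and]
  exact (Equiv.comp_symm_eq τ u (u ∘ σ)).symm

section Sorting

variable {β : Type*} [LinearOrder K] [LinearOrder β]

theorem exists_mem_permOrbit_monovary (u : ι → K) (g : ι → β) :
    ∃ v ∈ permOrbit u, Monovary v g := by
  obtain ⟨a, ha⟩ := exists_equiv_fin_monotone u
  obtain ⟨b, hb⟩ := exists_equiv_fin_monotone g
  refine ⟨u ∘ b.symm.trans a, mem_permOrbit.2 ⟨_, rfl⟩, fun i j hij => ha ?_⟩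
  refine le_of_not_gt fun h => hij.not_ge ?_
  simpa using hb h.le

theorem eq_of_monovary_of_injective {u v w : ι → K} {g : ι → β} (hg : Function.Injective g)
    (hv : v ∈ permOrbit u) (hw : w ∈ permOrbit u) (hvg : Monovary v g) (hwg : Monovary w g) :
    v = w := by
  obtain ⟨e, he⟩ := exists_equiv_fin_monotone g
  have hstrict : StrictMono (g ∘ e) := he.strictMono_of_injective (hg.comp e.injective)
  have hmono {x : ι → K} (hx : Monovary x g) : Monotone (x ∘ e) := fun i j hij =>
    hij.eq_or_lt.elim (fun h => h ▸ le_rfl) fun h => hx (hstrict h)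
  obtain ⟨σ, rfl⟩ := mem_permOrbit.1 (permOrbit_eq_of_mem hv ▸ hw)
  have hσ : (v ∘ e) ∘ (e.trans (σ.trans e.symm)) = (v ∘ σ) ∘ e := by ext i; simp
  have := Tuple.unique_monotone (σ := 1) (hmono hvg) (hσ ▸ hmono hwg)
  rw [hσ] at this
  exact e.surjective.injective_comp_right this

end Sorting

section Maximizers

variable [Field K] [LinearOrder K]

/-- The points of the orbit of `u` that maximize the functional with coefficients `c`. -/
def orbitMaximizers (u c : ι → K) : Set (ι → K) :=
  {v | v ∈ permOrbit u ∧ ∀ w ∈ permOrbit u, c ⬝ᵥ w ≤ c ⬝ᵥ v}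

theorem dotProduct_eq_of_mem_orbitMaximizers {u c v w : ι → K} (hv : v ∈ orbitMaximizers u c)
    (hw : w ∈ orbitMaximizers u c) : c ⬝ᵥ w = c ⬝ᵥ v :=
  (hv.2 w hw.1).antisymm (hw.2 v hv.1)

variable [IsStrictOrderedRing K]

theorem mem_orbitMaximizers {u c v : ι → K} :
    v ∈ orbitMaximizers u c ↔ v ∈ permOrbit u ∧ Monovary v c := by
  have hle {x y : ι → K} (hx : x ∈ permOrbit u) (hy : y ∈ permOrbit u) (hxc : Monovary x c) :
      c ⬝ᵥ y ≤ c ⬝ᵥ x ∧ (c ⬝ᵥ y = c ⬝ᵥ x → Monovary y c) := by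
    obtain ⟨σ, rfl⟩ := mem_permOrbit.1 (permOrbit_eq_of_mem hx ▸ hy)
    exact ⟨hxc.symm.sum_mul_comp_perm_le_sum_mul,
      fun h => (hxc.symm.sum_mul_comp_perm_eq_sum_mul_iff.1 h).symm⟩
  constructor
  · rintro ⟨hv, hmax⟩
    obtain ⟨x, hx, hxc⟩ := exists_mem_permOrbit_monovary u c
    exact ⟨hv, (hle hx hv hxc).2 ((hle hx hv hxc).1.antisymm (hmax x hx))⟩
  · rintro ⟨hv, hvc⟩
    exact ⟨hv, fun w hw => (hle hv hw hvc).1⟩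

theorem isFace_convexHull_permOrbit_iff {u : ι → K} {F : Set (ι → K)} :
    IsFace K (convexHull K (permOrbit u : Set (ι → K))) F ↔
      ∃ c, F = convexHull K (orbitMaximizers u c) := by
  rw [isFace_convexHull_iff, (dotProductEquiv K ι).surjective.exists]
  refine ⟨fun ⟨_, c, hc⟩ => ⟨c, hc⟩, fun ⟨c, hc⟩ => ⟨?_, c, hc⟩⟩
  obtain ⟨v, hv⟩ := exists_mem_permOrbit_monovary u c
  exact hc ▸ ⟨v, subset_convexHull K _ (mem_orbitMaximizers.2 hv)⟩

theorem permOrbit_inter_convexHull_orbitMaximizers (u c : ι → K) :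
    (permOrbit u : Set (ι → K)) ∩ convexHull K (orbitMaximizers u c) = orbitMaximizers u c :=
  inter_convexHull_maximizers _ (dotProductEquiv K ι c)

end Maximizers

end PermOrbit

section Covers

open Equiv Matrix

section Order

variable {ι α β : Type*} [Fintype ι] [LinearOrder α] [LinearOrder β]

/-- The pairs of coordinates at which `v` takes consecutive values, the smaller value first. The
conditions `c p.1 ≤ c p.2` cut out the cone of all functionals `c` that attain their maximum over
the orbit of `v` at `v`. -/
def coverPairs (v : ι → α) : Finset (ι × ι) :=
  Finset.univ.filter fun p => v p.1 < v p.2 ∧ ∀ z, v z ≤ v p.1 ∨ v p.2 ≤ v z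

theorem mem_coverPairs {v : ι → α} {p : ι × ι} :
    p ∈ coverPairs v ↔ v p.1 < v p.2 ∧ ∀ z, v z ≤ v p.1 ∨ v p.2 ≤ v z := by
  simp [coverPairs]

theorem mem_coverPairs_comp {v : ι → α} {σ : Perm ι} {p : ι × ι} :
    p ∈ coverPairs (v ∘ σ) ↔ (σ p.1, σ p.2) ∈ coverPairs v := by
  simp only [mem_coverPairs, Function.comp_apply]
  rw [σ.forall_congr_right (q := fun z => v z ≤ v (σ p.1) ∨ v (σ p.2) ≤ v z)]

theorem monovary_iff_forall_coverPairs {v : ι → α} {g : ι → β} :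
    Monovary v g ↔ ∀ p ∈ coverPairs v, g p.1 ≤ g p.2 := by
  refine ⟨fun h p hp => h.symm (mem_coverPairs.1 hp).1, fun h => Monovary.symm ?_⟩
  intro x y hxy
  induction hk : (Finset.univ.filter fun z => v x < v z ∧ v z < v y).card using
    Nat.strong_induction_on generalizing x y with
  | _ k ih =>
    by_cases hp : (x, y) ∈ coverPairs v
    · exact h _ hp
    obtain ⟨z, hxz, hzy⟩ : ∃ z, v x < v z ∧ v z < v y := by
      simpa [mem_coverPairs, hxy] using hp
    have hz : z ∈ Finset.univ.filter fun z => v x < v z ∧ v z < v y := by simp [hxz, hzy]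
    have hlt {t : Finset ι} (ht : t ⊆ Finset.univ.filter fun z => v x < v z ∧ v z < v y)
        (hzt : z ∉ t) : t.card < k :=
      hk ▸ Finset.card_lt_card (Finset.ssubset_iff_of_subset ht |>.2 ⟨z, hz, hzt⟩)
    refine (ih _ (hlt ?_ ?_) hxz rfl).trans (ih _ (hlt ?_ ?_) hzy rfl)
    · exact Finset.monotone_filter_right _ fun a _ ha => ⟨ha.1, ha.2.trans hzy⟩
    · simp
    · exact Finset.monotone_filter_right _ fun a _ ha => ⟨hxz.trans ha.1, ha.2⟩
    · simp

/-- The cover pairs of `v` on which `g` is constant. For a functional `c` they span the directions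
of the face of the orbit polytope on which `c` is maximal. -/
def tightPairs (v : ι → α) (g : ι → β) : Finset (ι × ι) :=
  (coverPairs v).filter fun p => g p.1 = g p.2

theorem mem_tightPairs {v : ι → α} {g : ι → β} {p : ι × ι} :
    p ∈ tightPairs v g ↔ p ∈ coverPairs v ∧ g p.1 = g p.2 :=
  Finset.mem_filter

theorem tightPairs_subset (v : ι → α) (g : ι → β) : tightPairs v g ⊆ coverPairs v :=
  Finset.filter_subset _ _

end Order

section Roots

variable {ι : Type*} [DecidableEq ι]

/-- The root `e_y - e_x` of a pair of coordinates `(x, y)`. -/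
def coverRoot (K : Type*) [Field K] (p : ι × ι) : ι → K :=
  Pi.single p.2 1 - Pi.single p.1 1

variable {K : Type*} [Field K]

theorem dotProduct_coverRoot [Fintype ι] (c : ι → K) (p : ι × ι) :
    c ⬝ᵥ coverRoot K p = c p.2 - c p.1 := by
  simp [coverRoot, dotProduct_sub]

theorem comp_swap_eq_sub_smul_coverRoot (v : ι → K) (p : ι × ι) :
    v ∘ swap p.1 p.2 = v - (v p.2 - v p.1) • coverRoot K p := by
  ext i
  simp only [Function.comp_apply, swap_apply_def, coverRoot, Pi.sub_apply, Pi.smul_apply,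
    Pi.single_apply, smul_eq_mul]
  split_ifs <;> simp_all

theorem dotProduct_eq_zero_of_mem_span_coverRoot [Fintype ι] {c x : ι → K} {S : Finset (ι × ι)}
    (hc : ∀ p ∈ S, c p.1 = c p.2) (hx : x ∈ Submodule.span K (coverRoot K '' S)) :
    c ⬝ᵥ x = 0 := by
  have hle : Submodule.span K (coverRoot K '' S) ≤ LinearMap.ker (dotProductEquiv K ι c) := by
    rw [Submodule.span_le]
    rintro _ ⟨p, hp, rfl⟩
    simp [dotProduct_coverRoot, hc p hp]
  exact hle hx

end Roots

theorem exists_monovary_smul_add {ι K : Type*} [Fintype ι] [Field K] [LinearOrder K]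
    [IsStrictOrderedRing K] {v c d : ι → K} (hvc : Monovary v c)
    (hd : ∀ p ∈ tightPairs v c, d p.1 = d p.2) : ∃ M : K, Monovary v (M • c + d) := by
  have hlarge : ∀ᶠ M : K in Filter.atTop,
      ∀ p ∈ coverPairs v, (M • c + d) p.1 ≤ (M • c + d) p.2 := by
    rw [Filter.eventually_all_finset]
    intro p hp
    simp only [Pi.add_apply, Pi.smul_apply, smul_eq_mul]
    obtain heq | hlt := (monovary_iff_forall_coverPairs.1 hvc p hp).eq_or_lt
    · rw [heq, hd p (mem_tightPairs.2 ⟨hp, heq⟩)]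
      exact Filter.Eventually.of_forall fun _ => le_rfl
    · filter_upwards [Filter.eventually_ge_atTop ((d p.1 - d p.2) / (c p.2 - c p.1))] with M hM
      rw [div_le_iff₀ (sub_pos.2 hlt)] at hM
      linarith
  exact hlarge.exists.imp fun M hM => monovary_iff_forall_coverPairs.2 hM

variable {ι K : Type*} [Fintype ι] [DecidableEq ι] [Field K] [LinearOrder K]

/-- The points of the orbit of `v` that differ from `v` by a combination of the roots of `S`. -/
def faceVertices (v : ι → K) (S : Finset (ι × ι)) : Set (ι → K) :=
  {w | w ∈ permOrbit v ∧ w - v ∈ Submodule.span K (coverRoot K '' S)}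

theorem vectorSpan_faceVertices {v : ι → K} {S : Finset (ι × ι)} (hS : S ⊆ coverPairs v) :
    vectorSpan K (faceVertices v S) = Submodule.span K (coverRoot K '' S) := by
  have hv : v ∈ faceVertices v S := ⟨self_mem_permOrbit v, by simp⟩
  rw [vectorSpan_eq_span_vsub_set_right K hv]
  refine le_antisymm (Submodule.span_le.2 ?_) (Submodule.span_le.2 ?_)
  · rintro _ ⟨w, hw, rfl⟩
    exact hw.2
  · rintro _ ⟨p, hp, rfl⟩
    have hne : v p.2 - v p.1 ≠ 0 := sub_ne_zero.2 (mem_coverPairs.1 (hS hp)).1.ne'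
    have hdiff : v ∘ swap p.1 p.2 - v = -(v p.2 - v p.1) • coverRoot K p := by
      rw [comp_swap_eq_sub_smul_coverRoot, sub_sub_cancel_left, neg_smul]
    have hswap : v ∘ swap p.1 p.2 ∈ faceVertices v S := by
      refine ⟨comp_mem_permOrbit (self_mem_permOrbit v) _, hdiff ▸ ?_⟩
      exact Submodule.smul_mem _ _ (Submodule.subset_span ⟨p, hp, rfl⟩)
    rw [SetLike.mem_coe, ← Submodule.smul_mem_iff _ (neg_ne_zero.2 hne), ← hdiff]
    exact Submodule.subset_span ⟨_, hswap, rfl⟩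

variable [IsStrictOrderedRing K]

theorem dotProduct_le_of_mem_orbitMaximizers {u v w c d : ι → K} (hv : v ∈ orbitMaximizers u c)
    (hw : w ∈ orbitMaximizers u c) (hd : ∀ p ∈ tightPairs v c, d p.1 = d p.2) :
    d ⬝ᵥ w ≤ d ⬝ᵥ v := by
  obtain ⟨M, hM⟩ := exists_monovary_smul_add (mem_orbitMaximizers.1 hv).2 hd
  have hle := (mem_orbitMaximizers.2 ⟨hv.1, hM⟩).2 w hw.1
  simpa only [add_dotProduct, smul_dotProduct, dotProduct_eq_of_mem_orbitMaximizers hv hw,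
    add_le_add_iff_left] using hle

theorem sub_mem_span_of_mem_orbitMaximizers {u v w c : ι → K} (hv : v ∈ orbitMaximizers u c)
    (hw : w ∈ orbitMaximizers u c) :
    w - v ∈ Submodule.span K (coverRoot K '' tightPairs v c) := by
  rw [← Subspace.forall_mem_dualAnnihilator_apply_eq_zero_iff,
    (dotProductEquiv K ι).surjective.forall]
  intro d hd
  have htight : ∀ p ∈ tightPairs v c, d p.1 = d p.2 := by
    intro p hp
    have := (Submodule.mem_dualAnnihilator _).1 hd _ (Submodule.subset_span ⟨p, hp, rfl⟩)
    exact (sub_eq_zero.1 ((dotProduct_coverRoot d p).symm.trans this)).symm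
  have hle := dotProduct_le_of_mem_orbitMaximizers hv hw htight
  have hge := dotProduct_le_of_mem_orbitMaximizers (d := -d) hv hw fun p hp => by
    simp [htight p hp]
  rw [neg_dotProduct, neg_dotProduct, neg_le_neg_iff] at hge
  simpa [dotProduct_sub, sub_eq_zero] using hle.antisymm hge

theorem orbitMaximizers_eq_faceVertices {u v c : ι → K} (hv : v ∈ orbitMaximizers u c) :
    orbitMaximizers u c = faceVertices v (tightPairs v c) := by
  ext w
  rw [faceVertices, permOrbit_eq_of_mem hv.1]
  refine ⟨fun hw => ⟨hw.1, sub_mem_span_of_mem_orbitMaximizers hv hw⟩, fun ⟨hw, hspan⟩ => ?_⟩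
  have heq : c ⬝ᵥ w - c ⬝ᵥ v = 0 := dotProduct_sub c w v ▸
    dotProduct_eq_zero_of_mem_span_coverRoot (fun p hp => (mem_tightPairs.1 hp).2) hspan
  exact ⟨hw, fun y hy => (hv.2 y hy).trans (sub_eq_zero.1 heq).ge⟩

end Covers

section IndependentCovers

open Equiv Matrix

theorem exists_dual_forall_apply_eq {α K V : Type*} [Field K] [AddCommGroup V] [Module K V]
    {b : α → V} (hb : LinearIndependent K b) (f : α → K) :
    ∃ φ : Module.Dual K V, ∀ i, φ (b i) = f i := by
  obtain ⟨g, hg⟩ := LinearMap.exists_leftInverse_of_injective _ (LinearMap.ker_eq_bot.2 hb)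
  refine ⟨Finsupp.linearCombination K f ∘ₗ g, fun i => ?_⟩
  have : g (b i) = Finsupp.single i 1 := by
    simpa using LinearMap.congr_fun hg (Finsupp.single i 1)
  simp [this]

theorem subset_of_span_image_le {α K V : Type*} [Field K] [AddCommGroup V] [Module K V]
    {b : α → V} {s t u : Set α} (hu : LinearIndepOn K b u) (hs : s ⊆ u) (ht : t ⊆ u)
    (h : Submodule.span K (b '' s) ≤ Submodule.span K (b '' t)) : s ⊆ t := fun i hi =>
  (hu.mono ht).mem_span_iff.1 (h (Submodule.subset_span ⟨i, hi, rfl⟩))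
    (hu.mono (Set.insert_subset (hs hi) ht))

variable {ι K : Type*} [Fintype ι] [DecidableEq ι] [Field K] [LinearOrder K]

/-- The roots of the cover pairs of `v` are linearly independent, which makes the normal cone of
the orbit polytope at `v` simplicial. -/
def IndependentCovers (v : ι → K) : Prop :=
  LinearIndepOn K (coverRoot K) (coverPairs v : Set (ι × ι))

theorem IndependentCovers.injOn_convexHull_faceVertices {v : ι → K} (hv : IndependentCovers v) :
    Set.InjOn (fun S => convexHull K (faceVertices v S))
      {S : Finset (ι × ι) | S ⊆ coverPairs v} := by
  intro S hS T hT h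
  have hspan : Submodule.span K (coverRoot K '' (S : Set (ι × ι))) =
      Submodule.span K (coverRoot K '' (T : Set (ι × ι))) := by
    rw [← vectorSpan_faceVertices hS, ← vectorSpan_faceVertices hT]
    have := congrArg (fun F => (affineSpan K F).direction) h
    simpa only [affineSpan_convexHull, direction_affineSpan] using this
  exact Finset.coe_injective ((subset_of_span_image_le hv hS hT hspan.le).antisymm
    (subset_of_span_image_le hv hT hS hspan.ge))

theorem IndependentCovers.affDim_convexHull_faceVertices {v : ι → K} (hv : IndependentCovers v)
    {S : Finset (ι × ι)} (hS : S ⊆ coverPairs v) :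
    affDim K (convexHull K (faceVertices v S)) = S.card := by
  rw [affDim_convexHull, affDim, vectorSpan_faceVertices hS, Set.image_eq_range,
    finrank_span_eq_card (hv.mono hS)]
  exact Fintype.card_coe S

variable [IsStrictOrderedRing K]

theorem IndependentCovers.exists_tightPairs_eq {v : ι → K} (hv : IndependentCovers v)
    {S : Finset (ι × ι)} (hS : S ⊆ coverPairs v) :
    ∃ c : ι → K, Monovary v c ∧ tightPairs v c = S := by
  obtain ⟨φ, hφ⟩ := exists_dual_forall_apply_eq hv fun p => if p.1 ∈ S then 0 else 1
  obtain ⟨c, rfl⟩ := (dotProductEquiv K ι).surjective φ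
  have hc (p) (hp : p ∈ coverPairs v) : c p.2 - c p.1 = if p ∈ S then 0 else 1 :=
    (dotProduct_coverRoot c p).symm.trans (hφ ⟨p, hp⟩)
  refine ⟨c, monovary_iff_forall_coverPairs.2 fun p hp => ?_, ?_⟩
  · rw [← sub_nonneg, hc p hp]
    split_ifs <;> simp
  · ext p
    rw [mem_tightPairs, eq_comm (a := c p.1), ← sub_eq_zero]
    constructor
    · rintro ⟨hp, h⟩
      simpa [hc p hp] using h
    · exact fun hp => ⟨hS hp, (hc p (hS hp)).trans (if_pos hp)⟩

theorem IndependentCovers.isFace_and_mem_iff {u v : ι → K} (hv : IndependentCovers v)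
    (hvu : v ∈ permOrbit u) {F : Set (ι → K)} :
    IsFace K (convexHull K (permOrbit u : Set (ι → K))) F ∧ v ∈ F ↔
      ∃ S ⊆ coverPairs v, convexHull K (faceVertices v S) = F := by
  rw [isFace_convexHull_permOrbit_iff]
  constructor
  · rintro ⟨⟨c, rfl⟩, hvF⟩
    have hvc : v ∈ orbitMaximizers u c :=
      permOrbit_inter_convexHull_orbitMaximizers u c ▸ ⟨hvu, hvF⟩
    exact ⟨tightPairs v c, tightPairs_subset v c, by rw [orbitMaximizers_eq_faceVertices hvc]⟩
  · rintro ⟨S, hS, rfl⟩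
    obtain ⟨c, hvc, rfl⟩ := hv.exists_tightPairs_eq hS
    have hv' : v ∈ orbitMaximizers u c := mem_orbitMaximizers.2 ⟨hvu, hvc⟩
    rw [← orbitMaximizers_eq_faceVertices hv']
    exact ⟨⟨c, rfl⟩, subset_convexHull K _ hv'⟩

theorem convexHull_permOrbit_eq_convexHull_faceVertices {u v : ι → K} (hvu : v ∈ permOrbit u) :
    convexHull K (permOrbit u : Set (ι → K)) = convexHull K (faceVertices v (coverPairs v)) := by
  have hmax : orbitMaximizers u 0 = permOrbit u := by ext; simp [orbitMaximizers]
  have htight : tightPairs v (0 : ι → K) = coverPairs v := by simp [tightPairs]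
  rw [← htight, ← orbitMaximizers_eq_faceVertices (hmax.superset hvu), hmax]

theorem isSimplePolytope_convexHull_permOrbit {u : ι → K}
    (hu : ∀ v ∈ permOrbit u, IndependentCovers v) :
    IsSimplePolytope K (convexHull K (permOrbit u : Set (ι → K))) := by
  refine ⟨⟨_, (permOrbit u).finite_toSet, rfl⟩, fun v hv => ?_⟩
  have hvu : v ∈ permOrbit u := by
    obtain ⟨c, hc⟩ := isFace_convexHull_permOrbit_iff.1 hv
    obtain ⟨w, hw⟩ := convexHull_nonempty_iff.1 (hc ▸ Set.singleton_nonempty v)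
    obtain rfl : w = v := hc.symm.subset (subset_convexHull K _ hw)
    exact hw.1
  have hind := hu v hvu
  have hedges : {F | IsFace K (convexHull K (permOrbit u : Set (ι → K))) F ∧ affDim K F = 1 ∧
      v ∈ F} = (fun S => convexHull K (faceVertices v S)) '' ((coverPairs v).powersetCard 1) := by
    ext F
    simp only [Set.mem_ofPred_eq, and_left_comm (b := affDim K F = 1), hind.isFace_and_mem_iff hvu,
      Set.mem_image, Finset.mem_coe, Finset.mem_powersetCard]
    constructor
    · rintro ⟨hdim, S, hS, rfl⟩
      exact ⟨S, ⟨hS, hind.affDim_convexHull_faceVertices hS ▸ hdim⟩, rfl⟩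
    · rintro ⟨S, ⟨hS, hcard⟩, rfl⟩
      exact ⟨(hind.affDim_convexHull_faceVertices hS).trans hcard, S, hS, rfl⟩
  rw [hedges, (hind.injOn_convexHull_faceVertices.mono fun S hS =>
      (Finset.mem_powersetCard.1 hS).1).encard_image, Set.encard_coe_eq_coe_finsetCard,
    Finset.card_powersetCard, Nat.choose_one_right,
    convexHull_permOrbit_eq_convexHull_faceVertices hvu,
    hind.affDim_convexHull_faceVertices subset_rfl]

end IndependentCovers

section AscendingPairs

open Matrix

variable {ι K : Type*} [Fintype ι] [LinearOrder ι]

/-- The cover pairs of `v` whose larger value stands further to the right. -/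
def ascendingPairs [LinearOrder K] (v : ι → K) : Finset (ι × ι) :=
  (coverPairs v).filter fun p => p.1 < p.2

theorem ascendingPairs_subset [LinearOrder K] (v : ι → K) : ascendingPairs v ⊆ coverPairs v :=
  Finset.filter_subset _ _

theorem monovary_toLex_iff [LinearOrder K] {v c : ι → K} :
    Monovary v (fun x => toLex (c x, x)) ↔ Monovary v c ∧ tightPairs v c ⊆ ascendingPairs v := by
  simp only [monovary_iff_forall_coverPairs, Prod.Lex.toLex_le_toLex, Finset.subset_iff,
    mem_tightPairs, ascendingPairs, Finset.mem_filter]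
  have hne {p : ι × ι} (hp : p ∈ coverPairs v) : p.1 ≠ p.2 := fun h =>
    (mem_coverPairs.1 hp).1.ne (congrArg v h)
  constructor
  · intro h
    exact ⟨fun p hp => (h p hp).elim le_of_lt fun h => h.1.le,
      fun p hp => ⟨hp.1, ((h p hp.1).resolve_left hp.2.not_lt).2.lt_of_ne (hne hp.1)⟩⟩
  · rintro ⟨hle, hasc⟩ p hp
    exact (hle p hp).lt_or_eq.imp_right fun h => ⟨h, (hasc ⟨hp, h⟩).2.le⟩

variable [Field K] [LinearOrder K] [IsStrictOrderedRing K]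

/-- Perturbing a functional `c` lexicographically by the order of the coordinates singles out one
vertex of the face on which `c` is maximal: the vertex at which all tight pairs are ascending. -/
theorem bijOn_convexHull_faceVertices {u : ι → K} (hu : ∀ v ∈ permOrbit u, IndependentCovers v) :
    Set.BijOn (fun a : (_ : ι → K) × Finset (ι × ι) => convexHull K (faceVertices a.1 a.2))
      ((permOrbit u).sigma fun v => (ascendingPairs v).powerset)
      {F | IsFace K (convexHull K (permOrbit u : Set (ι → K))) F} := by
  simp only [Finset.coe_sigma]
  refine ⟨?_, ?_, ?_⟩
  · rintro ⟨v, S⟩ ⟨hv, hS⟩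
    have hS' := (Finset.mem_powerset.1 hS).trans (ascendingPairs_subset v)
    exact (((hu v hv).isFace_and_mem_iff hv).2 ⟨S, hS', rfl⟩).1
  · rintro ⟨v, S⟩ ⟨hv, hS⟩ ⟨w, T⟩ ⟨hw, hT⟩ h
    change convexHull K (faceVertices v S) = convexHull K (faceVertices w T) at h
    rw [Finset.mem_coe, Finset.mem_powerset] at hS hT
    have hT' := hT.trans (ascendingPairs_subset w)
    obtain ⟨c, hvc, rfl⟩ :=
      (hu v hv).exists_tightPairs_eq (hS.trans (ascendingPairs_subset v))
    have hF := orbitMaximizers_eq_faceVertices (mem_orbitMaximizers.2 ⟨hv, hvc⟩)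
    have hwc : w ∈ orbitMaximizers u c := by
      rw [← permOrbit_inter_convexHull_orbitMaximizers, hF, h]
      exact ⟨hw, subset_convexHull K _ ⟨self_mem_permOrbit w, by simp⟩⟩
    have hface : convexHull K (faceVertices w (tightPairs w c)) =
        convexHull K (faceVertices w T) := by
      rw [← h, ← hF, orbitMaximizers_eq_faceVertices hwc]
    have htight : tightPairs w c = T :=
      (hu w hw).injOn_convexHull_faceVertices (tightPairs_subset w c) hT' hface
    have hlex : Function.Injective fun x => toLex (c x, x) := fun x y hxy =>
      congrArg (fun a => (ofLex a).2) hxy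
    obtain rfl : v = w := eq_of_monovary_of_injective hlex hv hw
      (monovary_toLex_iff.2 ⟨hvc, hS⟩)
      (monovary_toLex_iff.2 ⟨(mem_orbitMaximizers.1 hwc).2, htight ▸ hT⟩)
    rw [htight]
  · intro F hF
    obtain ⟨c, rfl⟩ := isFace_convexHull_permOrbit_iff.1 hF
    obtain ⟨v, hv, hvc⟩ := exists_mem_permOrbit_monovary u fun x => toLex (c x, x)
    obtain ⟨hvc, hasc⟩ := monovary_toLex_iff.1 hvc
    refine ⟨⟨v, tightPairs v c⟩, ⟨hv, Finset.mem_powerset.2 hasc⟩, ?_⟩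
    exact congrArg _ (orbitMaximizers_eq_faceVertices (mem_orbitMaximizers.2 ⟨hv, hvc⟩)).symm

theorem hPolynomial_convexHull_permOrbit {u : ι → K}
    (hu : ∀ v ∈ permOrbit u, IndependentCovers v) :
    hPolynomial K (convexHull K (permOrbit u : Set (ι → K))) =
      ∑ v ∈ permOrbit u, X ^ (ascendingPairs v).card := by
  rw [hPolynomial_eq_sum (bijOn_convexHull_faceVertices hu), Finset.sum_sigma]
  refine Finset.sum_congr rfl fun v hv => ?_
  calc ∑ S ∈ (ascendingPairs v).powerset,
        (X - 1 : ℤ[X]) ^ affDim K (convexHull K (faceVertices v S))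
      = ∑ S ∈ (ascendingPairs v).powerset,
          (X - 1) ^ S.card * 1 ^ ((ascendingPairs v).card - S.card) := by
        refine Finset.sum_congr rfl fun S hS => ?_
        rw [(hu v hv).affDim_convexHull_faceVertices
          ((Finset.mem_powerset.1 hS).trans (ascendingPairs_subset v)), one_pow, mul_one]
    _ = X ^ (ascendingPairs v).card := by
        rw [Finset.sum_pow_mul_eq_add_pow, sub_add_cancel]

end AscendingPairs

section InjectiveAboveMin

open Equiv Matrix

/-- `v` takes each value other than its smallest one at most once. -/
def InjectiveAboveMin {ι α : Type*} [LT α] (v : ι → α) : Prop :=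
  Set.InjOn v {x | ∃ z, v z < v x}

theorem InjectiveAboveMin.comp_perm {ι α : Type*} [LT α] {v : ι → α} (hv : InjectiveAboveMin v)
    (σ : Perm ι) : InjectiveAboveMin (v ∘ σ) :=
  fun _ ⟨a, ha⟩ _ ⟨b, hb⟩ h => σ.injective (hv ⟨σ a, ha⟩ ⟨σ b, hb⟩ h)

variable {ι K : Type*} [Fintype ι] [LinearOrder K]

theorem InjectiveAboveMin.eq_or_iff_of_mem_coverPairs {v : ι → K} (hv : InjectiveAboveMin v)
    {p q : ι × ι} (hp : p ∈ coverPairs v) (hq : q ∈ coverPairs v) :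
    p = q ∨ ((q.1 = p.1 ∨ v q.1 < v p.1) ↔ (q.2 = p.1 ∨ v q.2 < v p.1)) := by
  obtain ⟨hpv, hpz⟩ := mem_coverPairs.1 hp
  obtain ⟨hqv, hqz⟩ := mem_coverPairs.1 hq
  by_cases hpq : p.1 = q.1
  · have hle : v p.2 ≤ v q.2 := (hpz q.2).resolve_left (hpq ▸ hqv).not_ge
    have hge : v q.2 ≤ v p.2 := (hqz p.2).resolve_left (hpq ▸ hpv).not_ge
    exact Or.inl (Prod.ext hpq (hv ⟨_, hpv⟩ ⟨_, hqv⟩ (hle.antisymm hge)))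
  refine Or.inr ⟨fun h => ?_, fun h => ?_⟩
  · have hlt := h.resolve_left fun h => hpq h.symm
    exact ((hqz p.1).resolve_left hlt.not_ge).eq_or_lt.imp
      (fun h => hv ⟨_, hqv⟩ ⟨_, hlt⟩ h) id
  · exact Or.inr (h.elim (fun h => h ▸ hqv) hqv.trans)

/-- The functional dual to the root of a cover pair `(x, y)` is minus the sum of the coordinates in
`{z | z = x ∨ v z < v x}`, since `(x, y)` is the only cover pair that leaves this set. -/
theorem InjectiveAboveMin.independentCovers [DecidableEq ι] [Field K] {v : ι → K}
    (hv : InjectiveAboveMin v) : IndependentCovers v := by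
  refine LinearIndependent.of_pairwise_dual_eq_zero_one _ (fun p : coverPairs v =>
    dotProductEquiv K ι fun z => if z = p.1.1 ∨ v z < v p.1.1 then -1 else 0) ?_ ?_
  · rintro p q hpq
    have h := (hv.eq_or_iff_of_mem_coverPairs p.2 q.2).resolve_left fun h => hpq (Subtype.ext h)
    simp [dotProduct_coverRoot, h]
  · intro p
    have hlt := (mem_coverPairs.1 p.2).1
    have hne : p.1.2 ≠ p.1.1 := fun h => hlt.ne' (congrArg v h)
    simp [dotProduct_coverRoot, hne, hlt.le]

end InjectiveAboveMin

section Ascents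

open Equiv

section Words

variable {α : Type*} [LinearOrder α]

/-- The number of ascents of the word `f 0 … f (n - 1)`; it extends `ascentCount` to words that are
not permutations, such as the words left after deleting letters of a permutation. -/
def wordAscentCount {n : ℕ} (f : Fin n → α) : ℕ :=
  (Finset.univ.filter fun i : Fin n => ∃ h : i.val + 1 < n, f i < f ⟨i.val + 1, h⟩).card

/-- The number of ascents of a word whose first two letters share a position, so that both are
followed by the third. The truncated difference `i - 1` is the position of the letter `i`. -/
def doubledAscentCount {n : ℕ} (f : Fin n → α) : ℕ :=
  (Finset.univ.filter fun i : Fin n => ∃ h : i.val - 1 + 2 < n, f i < f ⟨i.val - 1 + 2, h⟩).card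

theorem wordAscentCount_comp_strictMono {β : Type*} [LinearOrder β] {n : ℕ} {e : α → β}
    (he : StrictMono e) (f : Fin n → α) : wordAscentCount (e ∘ f) = wordAscentCount f := by
  simp only [wordAscentCount, Function.comp_apply, he.lt_iff_lt]

theorem wordAscentCount_eq_add_tail {n : ℕ} (f : Fin (n + 2) → α) :
    wordAscentCount f = (if f 0 < f 1 then 1 else 0) + wordAscentCount (Fin.tail f) := by
  rw [wordAscentCount, Fin.card_filter_univ_succ', wordAscentCount]
  simp [Fin.tail]

theorem doubledAscentCount_eq_zero (f : Fin 2 → α) : doubledAscentCount f = 0 := by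
  simp [doubledAscentCount]

theorem doubledAscentCount_eq_add_tail_tail {n : ℕ} (f : Fin (n + 3) → α) :
    doubledAscentCount f = (if f 0 < f 2 then 1 else 0) + ((if f 1 < f 2 then 1 else 0) +
      wordAscentCount (Fin.tail (Fin.tail f))) := by
  rw [doubledAscentCount, Fin.card_filter_univ_succ', Fin.card_filter_univ_succ', wordAscentCount]
  simp only [Fin.coe_ofNat_eq_mod, Nat.zero_mod, zero_tsub, zero_add, lt_add_iff_pos_left,
    Order.lt_add_one_iff, zero_le, exists_true_left, Fin.succ_zero_eq_one, Nat.one_mod, tsub_self,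
    Fin.val_succ, add_tsub_cancel_right, add_lt_add_iff_right, Order.add_one_le_iff, Fin.tail,
    Fin.succ_mk]
  rfl

theorem pow_doubledAscentCount_add {R : Type*} [CommSemiring R] (x : R) {n : ℕ}
    (f : Fin (n + 2) → α) (h01 : f 0 ≠ f 1) :
    x ^ doubledAscentCount f + x * x ^ wordAscentCount (Fin.tail (Fin.tail f)) =
      x ^ wordAscentCount f + x ^ wordAscentCount (f ∘ swap 0 1) := by
  have hswap : Fin.tail (Fin.tail (f ∘ swap 0 1)) = Fin.tail (Fin.tail f) := by
    ext i
    simp [Fin.tail, swap_apply_of_ne_of_ne, Fin.ext_iff]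
  cases n with
  | zero =>
    have hempty (g : Fin 0 → α) : wordAscentCount g = 0 := rfl
    have hone (g : Fin 1 → α) : wordAscentCount g = 0 :=
      Finset.card_eq_zero.2 (Finset.filter_eq_empty_iff.2 fun i _ ⟨h, _⟩ => by omega)
    simp only [doubledAscentCount_eq_zero, wordAscentCount_eq_add_tail, hempty, hone,
      Function.comp_apply, swap_apply_left, swap_apply_right]
    rcases h01.lt_or_gt with h | h <;> simp [h, h.not_gt, add_comm]
  | succ n =>
    have h2 : swap (0 : Fin (n + 3)) 1 2 = 2 :=
      swap_apply_of_ne_of_ne (ne_of_beq_false rfl) (ne_of_beq_false rfl)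
    have hexpand (g : Fin (n + 3) → α) : wordAscentCount g = (if g 0 < g 1 then 1 else 0) +
        ((if g 1 < g 2 then 1 else 0) + wordAscentCount (Fin.tail (Fin.tail g))) := by
      rw [wordAscentCount_eq_add_tail, wordAscentCount_eq_add_tail (Fin.tail g)]
      rfl
    rw [doubledAscentCount_eq_add_tail_tail, hexpand, hexpand, hswap]
    simp only [Function.comp_apply, swap_apply_left, swap_apply_right, h2]
    generalize wordAscentCount (Fin.tail (Fin.tail f)) = k
    rcases h01.lt_or_gt with h | h <;> simp only [h, h.not_gt, if_true, if_false] <;>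
      split_ifs <;> first | (exfalso; order) | ring

end Words

theorem eulerianPolynomial_eq_sum (n : ℕ) :
    eulerianPolynomial n = ∑ σ : Perm (Fin n), (X : ℤ[X]) ^ wordAscentCount σ := by
  have hmaps : ∀ σ ∈ (Finset.univ : Finset (Perm (Fin n))),
      wordAscentCount σ ∈ Finset.range (n + 1) := fun σ _ =>
    Finset.mem_range_succ_iff.2 ((Finset.card_le_univ _).trans (Fintype.card_fin n).le)
  rw [eulerianPolynomial, ← Finset.sum_fiberwise_of_maps_to hmaps]
  refine Finset.sum_congr rfl fun i _ => ?_
  rw [eulerianNumber, ← nsmul_eq_mul, ← Finset.sum_const]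
  exact Finset.sum_congr rfl fun σ hσ => congrArg _ (Finset.mem_filter.1 hσ).2.symm

/-- The permutation with first letter `a` whose remaining letters are in the relative order
given by `τ`. -/
def consPerm {n : ℕ} (a : Fin (n + 1)) (τ : Perm (Fin n)) : Perm (Fin (n + 1)) :=
  (finSuccEquiv' 0).trans (τ.optionCongr.trans (finSuccEquiv' a).symm)

theorem consPerm_zero {n : ℕ} (a : Fin (n + 1)) (τ : Perm (Fin n)) : consPerm a τ 0 = a := by
  simp [consPerm]

theorem tail_consPerm {n : ℕ} (a : Fin (n + 1)) (τ : Perm (Fin n)) :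
    Fin.tail (consPerm a τ) = a.succAbove ∘ τ := by
  ext i
  have : finSuccEquiv' (0 : Fin (n + 1)) i.succ = some i := by
    rw [← Fin.zero_succAbove, finSuccEquiv'_succAbove]
  simp [Fin.tail, consPerm, this]

theorem consPerm_bijective (n : ℕ) :
    Function.Bijective fun p : Fin (n + 1) × Perm (Fin n) => consPerm p.1 p.2 := by
  rw [Fintype.bijective_iff_injective_and_card]
  refine ⟨?_, by simp [Fintype.card_perm, Nat.factorial_succ]⟩
  rintro ⟨a, τ⟩ ⟨b, ρ⟩ (h : consPerm a τ = consPerm b ρ)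
  obtain rfl : a = b := by rw [← consPerm_zero a τ, h, consPerm_zero]
  have htail : a.succAbove ∘ τ = a.succAbove ∘ ρ := by rw [← tail_consPerm, h, tail_consPerm]
  exact Prod.ext rfl (DFunLike.coe_injective (Fin.succAbove_right_injective.comp_left htail))

theorem sum_perm_fin_succ {n : ℕ} {M : Type*} [AddCommMonoid M] (F : Perm (Fin (n + 1)) → M) :
    ∑ σ, F σ = ∑ a, ∑ τ, F (consPerm a τ) := by
  rw [← (consPerm_bijective n).sum_comp, Fintype.sum_prod_type]

theorem sum_pow_wordAscentCount_tail_tail (m : ℕ) :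
    ∑ σ : Perm (Fin (m + 2)), (X : ℤ[X]) ^ wordAscentCount (Fin.tail (Fin.tail σ)) =
      (m + 2) * (m + 1) * eulerianPolynomial m := by
  have htail (a : Fin (m + 2)) (b : Fin (m + 1)) (τ : Perm (Fin m)) :
      wordAscentCount (Fin.tail (Fin.tail (consPerm a (consPerm b τ)))) = wordAscentCount τ := by
    rw [tail_consPerm, ← wordAscentCount_comp_strictMono
      ((Fin.strictMono_succAbove a).comp (Fin.strictMono_succAbove b)), Function.comp_assoc,
      ← tail_consPerm]
    rfl
  simp only [sum_perm_fin_succ (n := m + 1), sum_perm_fin_succ (n := m), htail,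
    ← eulerianPolynomial_eq_sum, Finset.sum_const, Finset.card_univ, Fintype.card_fin,
    nsmul_eq_mul]
  push_cast
  ring

theorem sum_pow_doubledAscentCount (m : ℕ) :
    ∑ σ : Perm (Fin (m + 2)), (X : ℤ[X]) ^ doubledAscentCount σ =
      2 * (eulerianPolynomial (m + 2) - ((m + 2).choose 2 : ℤ[X]) * X * eulerianPolynomial m) := by
  have hsum := Finset.sum_congr (rfl : (Finset.univ : Finset (Perm (Fin (m + 2)))) = _)
    fun σ _ => pow_doubledAscentCount_add (X : ℤ[X]) σ (σ.injective.ne (by simp))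
  have hswap : ∑ σ : Perm (Fin (m + 2)), (X : ℤ[X]) ^ wordAscentCount (σ ∘ swap 0 1) =
      eulerianPolynomial (m + 2) := by
    rw [eulerianPolynomial_eq_sum]
    exact Equiv.sum_comp (Equiv.mulRight (swap 0 1))
      fun σ : Perm (Fin (m + 2)) => (X : ℤ[X]) ^ wordAscentCount σ
  have hchoose : (2 : ℤ[X]) * ((m + 2).choose 2 : ℤ[X]) = (m + 2) * (m + 1) := by
    have h := Nat.add_one_mul_choose_eq (m + 1) 1
    rw [Nat.choose_one_right] at h
    exact_mod_cast (mul_comm _ _).trans h.symm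
  rw [Finset.sum_add_distrib, Finset.sum_add_distrib, ← Finset.mul_sum, hswap,
    sum_pow_wordAscentCount_tail_tail, ← eulerianPolynomial_eq_sum, ← hchoose] at hsum
  linear_combination hsum

end Ascents

section DoubledMin

open Equiv

variable {K : Type*} [LinearOrder K] {m : ℕ} {u : Fin (m + 2) → K}

/-- The values of `u` are increasing, except that `u 0 = u 1`. The truncated difference `i - 1`
identifies the positions `0` and `1`. -/
def IsDoubledMin (u : Fin (m + 2) → K) : Prop :=
  ∀ i j, u i < u j ↔ i.val - 1 < j.val - 1

theorem IsDoubledMin.eq_iff (hu : IsDoubledMin u) (i j : Fin (m + 2)) :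
    u i = u j ↔ i.val - 1 = j.val - 1 := by
  simp only [eq_iff_le_not_lt, ← not_lt (a := u j), ← not_lt (a := j.val - 1), hu i j, hu j i]

theorem IsDoubledMin.injectiveAboveMin (hu : IsDoubledMin u) : InjectiveAboveMin u := by
  rintro i ⟨k, hk⟩ j - hij
  rw [hu k i] at hk
  rw [hu.eq_iff] at hij
  exact Fin.ext (by omega)

theorem IsDoubledMin.mem_coverPairs_iff (hu : IsDoubledMin u) (i j : Fin (m + 2)) :
    (i, j) ∈ coverPairs u ↔ j.val = i.val - 1 + 2 := by
  simp only [mem_coverPairs, ← not_lt, hu _ _]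
  constructor
  · rintro ⟨hlt, hz⟩
    have := hz ⟨i.val - 1 + 2, by omega⟩
    simp only at this
    omega
  · intro h
    exact ⟨by omega, fun z => by omega⟩

theorem IsDoubledMin.card_ascendingPairs (hu : IsDoubledMin u) (σ : Perm (Fin (m + 2))) :
    (ascendingPairs (u ∘ σ.symm)).card = doubledAscentCount σ := by
  refine Finset.card_bij (fun p _ => σ.symm p.1) ?_ ?_ ?_
  all_goals simp only [ascendingPairs, Finset.mem_filter, mem_coverPairs_comp,
    hu.mem_coverPairs_iff, Finset.mem_univ, true_and, Prod.forall]
  · rintro x y ⟨hxy, hlt⟩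
    refine ⟨hxy ▸ (σ.symm y).isLt, ?_⟩
    simpa [← hxy] using hlt
  · rintro x y ⟨hxy, -⟩ x' y' ⟨hxy', -⟩ h
    obtain rfl := σ.symm.injective h
    rw [← hxy', Fin.val_inj, σ.symm.injective.eq_iff] at hxy
    rw [hxy]
  · rintro i ⟨h, hlt⟩
    exact ⟨(σ i, σ ⟨i.val - 1 + 2, h⟩), by simp [hlt], by simp⟩

theorem IsDoubledMin.comp_perm_eq_iff (hu : IsDoubledMin u) (σ : Perm (Fin (m + 2))) :
    u ∘ σ = u ↔ σ = 1 ∨ σ = swap 0 1 := by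
  simp only [funext_iff, Function.comp_apply, hu.eq_iff]
  constructor
  · intro h
    have h01 : σ 0 ≠ σ 1 := σ.injective.ne (by simp)
    have hcases : (σ 0 = 0 ∧ σ 1 = 1) ∨ (σ 0 = 1 ∧ σ 1 = 0) := by
      have h0 := h 0
      have h1 := h 1
      simp only [Fin.ext_iff, Fin.val_zero, Fin.val_one, ne_eq] at h0 h1 h01 ⊢
      omega
    have hrest {i : Fin (m + 2)} (h0 : i ≠ 0) (h1 : i ≠ 1) : σ i = i := by
      have := h i
      simp only [Fin.ext_iff, Fin.val_zero, Fin.val_one, ne_eq] at h0 h1 ⊢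
      omega
    refine hcases.imp (fun ⟨h0, h1⟩ => Equiv.ext fun i => ?_) fun ⟨h0, h1⟩ => Equiv.ext fun i => ?_
    all_goals
      obtain rfl | hi0 := eq_or_ne i 0
      · simp [h0]
      obtain rfl | hi1 := eq_or_ne i 1
      · simp [h1]
      simp [hrest hi0 hi1, swap_apply_of_ne_of_ne hi0 hi1]
  · rintro (rfl | rfl) i
    · rfl
    · obtain rfl | hi0 := eq_or_ne i 0
      · simp
      obtain rfl | hi1 := eq_or_ne i 1
      · simp
      rw [swap_apply_of_ne_of_ne hi0 hi1]

theorem IsDoubledMin.card_stabilizer (hu : IsDoubledMin u) :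
    (Finset.univ.filter fun σ : Perm (Fin (m + 2)) => u ∘ σ = u).card = 2 := by
  have hne : (1 : Perm (Fin (m + 2))) ≠ swap 0 1 := fun h => by
    simpa using Equiv.congr_fun h 0
  have hstab : (Finset.univ.filter fun σ : Perm (Fin (m + 2)) => u ∘ σ = u) = {1, swap 0 1} := by
    ext σ
    simp [hu.comp_perm_eq_iff]
  rw [hstab, Finset.card_pair hne]

variable [Field K]

theorem IsDoubledMin.independentCovers (hu : IsDoubledMin u) :
    ∀ v ∈ permOrbit u, IndependentCovers v := by
  intro v hv
  obtain ⟨σ, rfl⟩ := mem_permOrbit.1 hv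
  exact (hu.injectiveAboveMin.comp_perm σ).independentCovers

variable [IsStrictOrderedRing K]

theorem IsDoubledMin.hPolynomial_convexHull_permOrbit (hu : IsDoubledMin u) :
    hPolynomial K (convexHull K (permOrbit u : Set (Fin (m + 2) → K))) =
      eulerianPolynomial (m + 2) - ((m + 2).choose 2 : ℤ[X]) * X * eulerianPolynomial m := by
  have hsum : (2 : ℤ[X]) * ∑ v ∈ permOrbit u, X ^ (ascendingPairs v).card =
      ∑ σ : Perm (Fin (m + 2)), X ^ doubledAscentCount σ := by
    calc (2 : ℤ[X]) * ∑ v ∈ permOrbit u, X ^ (ascendingPairs v).card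
        = ∑ σ : Perm (Fin (m + 2)), X ^ (ascendingPairs (u ∘ σ)).card := by
          rw [sum_comp_perm_eq_card_smul_sum_permOrbit u
              fun v => (X : ℤ[X]) ^ (ascendingPairs v).card,
            hu.card_stabilizer, nsmul_eq_mul, Nat.cast_two]
      _ = ∑ σ : Perm (Fin (m + 2)), X ^ (ascendingPairs (u ∘ σ.symm)).card :=
          (Equiv.sum_comp (Equiv.inv (Perm (Fin (m + 2))))
            fun σ => (X : ℤ[X]) ^ (ascendingPairs (u ∘ σ)).card).symm
      _ = ∑ σ : Perm (Fin (m + 2)), X ^ doubledAscentCount σ := by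
          simp only [hu.card_ascendingPairs]
  rw [sum_pow_doubledAscentCount] at hsum
  rw [_root_.hPolynomial_convexHull_permOrbit hu.independentCovers]
  exact mul_left_cancel₀ two_ne_zero hsum

end DoubledMin

section Weights

theorem simpleReflection_injective (n : ℕ) : Function.Injective (simpleReflection n) := by
  intro i j h
  have := congrArg (fun s : Equiv.Perm (Fin (n + 1)) => s i.castSucc) h
  simp only [simpleReflection, Equiv.swap_apply_left, Equiv.swap_apply_def] at this
  split_ifs at this with h1 h2
  · exact Fin.castSucc_injective n h1
  · simp only [Fin.ext_iff, Fin.val_succ, Fin.val_castSucc] at this h2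
    omega
  · simp [Fin.ext_iff] at this

variable {K : Type*}

theorem weylAct_simpleReflection_eq_iff {n : ℕ} (w : Fin (n + 1) → K) (i : Fin n) :
    weylAct (simpleReflection n i) w = w ↔ w i.castSucc = w i.succ := by
  constructor
  · intro h
    have := congrFun h i.succ
    simpa [weylAct, simpleReflection] using this
  · intro h
    ext k
    simp only [weylAct, simpleReflection, Equiv.symm_swap, Equiv.swap_apply_def]
    split_ifs with h1 h2
    · rw [h1, h]
    · rw [h2, h]
    · rfl

variable [Field K] [LinearOrder K]

theorem weightPolytope_eq_convexHull_permOrbit {n : ℕ} (w : Fin (n + 1) → K) :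
    weightPolytope w = convexHull K (permOrbit (w ∘ Fin.rev) : Set (Fin (n + 1) → K)) := by
  rw [weightPolytope]
  congr 1
  ext v
  rw [Finset.mem_coe, mem_permOrbit]
  constructor
  · rintro ⟨σ, rfl⟩
    exact ⟨σ.symm.trans Fin.revPerm, by ext i; simp [weylAct]⟩
  · rintro ⟨σ, rfl⟩
    exact ⟨(σ.trans Fin.revPerm).symm, by ext i; simp [weylAct]⟩

theorem isDominantOfType_last_iff {m : ℕ} (w : Fin (m + 2) → K) :
    IsDominantOfType {simpleReflection (m + 1) (Fin.last m)} w ↔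
      ∑ k, w k = 0 ∧ (∀ i : Fin (m + 1), w i.succ ≤ w i.castSucc) ∧
        ∀ i : Fin (m + 1), w i.castSucc = w i.succ ↔ i = Fin.last m := by
  refine and_congr_right fun _ => and_congr_right fun _ => ?_
  rw [Set.ext_iff]
  constructor
  · intro h i
    rw [← weylAct_simpleReflection_eq_iff, ← (simpleReflection_injective (m + 1)).eq_iff]
    have := h (simpleReflection (m + 1) i)
    simp only [Set.mem_singleton_iff, Set.mem_ofPred_eq, Set.mem_range_self, true_and] at this
    exact this.symm
  · intro h s
    simp only [Set.mem_singleton_iff, Set.mem_ofPred_eq]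
    constructor
    · rintro rfl
      exact ⟨⟨_, rfl⟩, (weylAct_simpleReflection_eq_iff w _).2 ((h _).2 rfl)⟩
    · rintro ⟨⟨i, rfl⟩, hi⟩
      rw [(h i).1 ((weylAct_simpleReflection_eq_iff w i).1 hi)]

theorem isDoubledMin_comp_rev {m : ℕ} {w : Fin (m + 2) → K}
    (hw : IsDominantOfType {simpleReflection (m + 1) (Fin.last m)} w) :
    IsDoubledMin (w ∘ Fin.rev) := by
  obtain ⟨-, hle, heq⟩ := (isDominantOfType_last_iff w).1 hw
  have hanti : Antitone w := Fin.antitone_iff_succ_le.2 hle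
  have hlast : w (Fin.last m).castSucc = w (Fin.last (m + 1)) := (heq _).2 rfl
  have hlt {i j : Fin (m + 2)} (hi : i.val < m) (hij : i < j) : w j < w i := by
    obtain ⟨k, rfl⟩ : ∃ k : Fin (m + 1), k.castSucc = i := ⟨⟨i.val, by omega⟩, rfl⟩
    have hne : w k.succ ≠ w k.castSucc := fun h => by
      simp [(heq k).1 h.symm] at hi
    exact (hanti (Fin.castSucc_lt_iff_succ_le.1 hij)).trans_lt ((hle k).lt_of_ne hne)
  intro i j
  refine ⟨fun h => ?_, fun h => hlt (by rw [Fin.val_rev]; omega) (Fin.rev_lt_rev.2 ?_)⟩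
  · by_contra hij
    obtain hji | ⟨hi, hj⟩ : j ≤ i ∨ i = 0 ∧ j = 1 := by
      simp only [Fin.le_def, Fin.ext_iff, Fin.val_zero, Fin.val_one]
      omega
    · exact h.not_ge (hanti (Fin.rev_le_rev.2 hji))
    · have hrev : (1 : Fin (m + 2)).rev = (Fin.last m).castSucc := Fin.ext (by simp)
      simp [hi, hj, hrev, hlast] at h
  · rw [Fin.lt_def]
    omega

theorem exists_isDominantOfType_last [IsStrictOrderedRing K] (m : ℕ) :
    ∃ w : Fin (m + 2) → K, IsDominantOfType {simpleReflection (m + 1) (Fin.last m)} w := by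
  refine ⟨fun k => (∑ i : Fin (m + 2), ((min i.val m : ℕ) : K)) / (m + 2) -
    ((min k.val m : ℕ) : K), (isDominantOfType_last_iff _).2 ⟨?_, ?_, ?_⟩⟩
  · have : (m + 2 : K) ≠ 0 := by positivity
    rw [Finset.sum_sub_distrib, Finset.sum_const, Finset.card_univ, Fintype.card_fin, nsmul_eq_mul]
    push_cast
    field_simp
    ring
  · intro i
    rw [sub_le_sub_iff_left, Nat.cast_le, Fin.val_succ, Fin.val_castSucc]
    omega
  · intro i
    rw [sub_right_inj, Nat.cast_inj, Fin.val_succ, Fin.val_castSucc, Fin.ext_iff, Fin.val_last]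
    omega

end Weights

theorem theorem5 (K : Type*) [Field K] [LinearOrder K] [IsStrictOrderedRing K]
    (n : ℕ) (hn : 1 ≤ n) (J : Set (Equiv.Perm (Fin (n + 1))))
    (hJ : J = {simpleReflection n ⟨n - 1, Nat.sub_lt hn Nat.one_pos⟩}) :
    CombinatoriallySmooth K J ∧
      ∀ w : Fin (n + 1) → K, IsDominantOfType J w →
        hPolynomial K (weightPolytope w) =
          eulerianPolynomial (n + 1) -
            ((n + 1).choose 2 : ℤ[X]) * X * eulerianPolynomial (n - 1) := by
  obtain ⟨m, rfl⟩ : ∃ m, n = m + 1 := ⟨n - 1, by omega⟩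
  subst hJ
  refine ⟨⟨exists_isDominantOfType_last m, fun w hw => ?_⟩, fun w hw => ?_⟩
  · rw [weightPolytope_eq_convexHull_permOrbit]
    exact isSimplePolytope_convexHull_permOrbit (isDoubledMin_comp_rev hw).independentCovers
  · rw [weightPolytope_eq_convexHull_permOrbit]
    exact (isDoubledMin_comp_rev hw).hPolynomial_convexHull_permOrbit
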